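/- For a group $F$ let $F_1=F$ and $F_{n+1}=[F_n,F]$ be its lower central series. Let $r\ge 1$, let $C_1,\dots,C_r$ be cyclic $2$-groups with generators $x_1,\dots,x_r$ respectively, let $2^{\alpha_i}$ be the order of $x_i$, and assume that $1\le\alpha_1\le\alpha_2\le\cdots\le\alpha_r$. Let $G$ be the $2$-nilpotent product of the $C_i$, that is, $G=F/F_3$, where $F=C_1*\cdots*C_r$ is the free product. Then $G$ is capable, meaning that there exists a group $H$ with $G\cong H/Z(H)$, where $Z(H)$ is the center of $H$, if and only if $r>1$ and $\alpha_r\le\alpha_{r-1}+1$. -/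

import Mathlib

universe u v

/-- The `k`-nilpotent product of a family of groups (each nilpotent of class at most `k`):
`F / F_{k+1}`, where `F` is the free product of the family and `F_1 = F`, `F_{n+1} = [F_n, F]`.
Mathlib starts the lower central series at index `0`, so its `k`-th term is `F_{k+1}`. -/
abbrev NilpotentProduct {ι : Type*} (k : ℕ) (A : ι → Type*) [∀ i, Group (A i)] : Type _ :=
  Monoid.CoprodI A ⧸ (⊤ : Subgroup (Monoid.CoprodI A)).lowerCentralSeries k

/-- A group `G` is capable if `G ≅ H / Z(H)` for some group `H` (of any universe level `v`). -/
def IsCapable (G : Type u) [Group G] : Prop :=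
  ∃ (H : Type v) (_ : Group H), Nonempty (G ≃* H ⧸ Subgroup.center H)

open scoped commutatorElement

/-! Necessity: if `G ≅ H / Z(H)`, then `H` has class at most three. Lift the generators to `y i`; a
power of `y last` commuting with every `y l` is central, so its exponent is divisible by `2 ^ α
last`. For `r = 1` the exponent 1 qualifies. Otherwise `y l ^ 2 ^ α prev` is central for `l ≠ last`,
and `commute_pow_two_mul` makes the exponent `2 * 2 ^ α prev` qualify.

Sufficiency: map the free group to a product of class-three groups `QuadGroup (ZMod (2 * 2 ^ α i))`,
one or two for each pair `i < j`. The image modulo its centre is `G` as soon as the words with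
central image are exactly the relations of `G` (`isCapable_of_freeGroup`). Relations have central
image by the universal property (`commute_lift_of_eq_one`). Conversely, centrality amounts to
congruences on the exponents of a word, and these force it to be trivial in `G`
(`TestCentral.lift_eq_one`). The delicate case is `α last = α prev + 1`, where comparing two test
groups for the pair `(prev, last)` gains the missing factor 2. -/

theorem Subgroup.lowerCentralSeries_two_eq_bot_iff {G : Type*} [Group G] :
    (⊤ : Subgroup G).lowerCentralSeries 2 = ⊥ ↔ ∀ a b c : G, ⁅⁅a, b⁆, c⁆ = 1 := by
  have h : ((⊤ : Subgroup G).lowerCentralSeries 1 ≤ Subgroup.centralizer (⊤ : Subgroup G)) ↔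
      ∀ a b c : G, ⁅⁅a, b⁆, c⁆ = 1 := by
    rw [Subgroup.lowerCentralSeries_succ, Subgroup.commutator_le]
    simp only [Subgroup.lowerCentralSeries_zero, Subgroup.mem_top, true_implies,
      Subgroup.mem_centralizer_iff_commutator_eq_one, Subgroup.coe_top, Set.mem_univ]
    refine ⟨fun h a b c => ?_, fun h a b c => ?_⟩
    · rw [← commutatorElement_inv, h, inv_one]
    · rw [← commutatorElement_inv, h, inv_one]
  rw [Subgroup.lowerCentralSeries_succ, Subgroup.commutator_eq_bot_iff_le_centralizer, h]

/-! ### The universal property of the 2-nilpotent product. -/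

namespace NilpotentProduct

variable {ι : Type*} {C : ι → Type*} [∀ i, Group (C i)]

theorem commutator_commutator_eq_one (a b c : NilpotentProduct 2 C) : ⁅⁅a, b⁆, c⁆ = 1 := by
  revert a b c
  rw [← Subgroup.lowerCentralSeries_two_eq_bot_iff]
  have hs := QuotientGroup.mk'_surjective ((⊤ : Subgroup (Monoid.CoprodI C)).lowerCentralSeries 2)
  rw [← Subgroup.map_top_of_surjective _ hs, ← Subgroup.map_lowerCentralSeries,
    QuotientGroup.map_mk'_self]

/-- The inclusion of a factor into the nilpotent product. -/
def incl (i : ι) : C i →* NilpotentProduct 2 C :=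
  (QuotientGroup.mk' _).comp Monoid.CoprodI.of

theorem exists_hom {Q : Type*} [Group Q] (hQ : ∀ a b c : Q, ⁅⁅a, b⁆, c⁆ = 1)
    (f : ∀ i, C i →* Q) : ∃ F : NilpotentProduct 2 C →* Q, ∀ i c, F (incl i c) = f i c := by
  refine ⟨QuotientGroup.lift _ (Monoid.CoprodI.lift f) fun w hw => ?_, fun i c => ?_⟩
  · have h := Subgroup.mem_map_of_mem (Monoid.CoprodI.lift f) hw
    rw [Subgroup.map_lowerCentralSeries] at h
    have h2 : (Subgroup.map (Monoid.CoprodI.lift f) ⊤).lowerCentralSeries 2 ≤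
        (⊤ : Subgroup Q).lowerCentralSeries 2 :=
      Subgroup.commutator_mono (Subgroup.commutator_mono le_top le_top) le_top
    have h3 := h2 h
    rwa [Subgroup.lowerCentralSeries_two_eq_bot_iff.2 hQ, Subgroup.mem_bot] at h3
  · change Monoid.CoprodI.lift f (Monoid.CoprodI.of c) = _
    simp

theorem incl_injective_of_comm (i : ι) (hc : ∀ a b : C i, a * b = b * a) :
    Function.Injective (incl i : C i →* NilpotentProduct 2 C) := by
  classical
  have hQ : ∀ a b c : C i, ⁅⁅a, b⁆, c⁆ = 1 := fun a b c => by
    rw [commutatorElement_eq_one_iff_mul_comm]; exact hc _ _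
  -- The retraction onto the factor `C i` that kills all the others.
  obtain ⟨F, hF⟩ := exists_hom hQ (Pi.mulSingle i (MonoidHom.id (C i)))
  refine Function.LeftInverse.injective (g := F) fun c => ?_
  rw [hF, Pi.mulSingle_eq_same]; rfl

theorem closure_incl_eq_top {x : (i : ι) → C i} (hx : ∀ i, Subgroup.zpowers (x i) = ⊤) :
    Subgroup.closure (Set.range fun i => (incl i (x i) : NilpotentProduct 2 C)) = ⊤ := by
  rw [eq_top_iff]
  rintro g -
  induction g using QuotientGroup.induction_on with
  | H w =>
    induction w using Monoid.CoprodI.induction_on with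
    | one => exact one_mem _
    | of i c =>
      obtain ⟨n, rfl⟩ : c ∈ Subgroup.zpowers (x i) := by simp [hx]
      change incl i (x i ^ n) ∈ _
      rw [map_zpow]
      exact zpow_mem (Subgroup.subset_closure (Set.mem_range_self i)) n
    | mul a b ha hb => exact mul_mem ha hb

end NilpotentProduct

/-- The witness is `φ.range`: an element of it is central iff it commutes with the images of the
generators, so `h` says that `π` and the map to `φ.range` modulo its centre have the same kernel.
`ULift` only adjusts the universe. -/
theorem isCapable_of_freeGroup {ι : Type*} {G : Type u} [Group G] {K : Type} [Group K]
    (π : FreeGroup ι →* G) (hπ : Function.Surjective π) (φ : FreeGroup ι →* K)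
    (h : ∀ w, π w = 1 ↔ ∀ l, Commute (φ w) (φ (FreeGroup.of l))) : IsCapable.{u, v} G := by
  let θ : FreeGroup ι →* ULift.{v} φ.range := MulEquiv.ulift.symm.toMonoidHom.comp φ.rangeRestrict
  have hθ : Function.Surjective θ := MulEquiv.ulift.symm.surjective.comp φ.rangeRestrict_surjective
  have hθ' : ∀ w, (θ w).down.1 = φ w := fun w => rfl
  let ψ := (QuotientGroup.mk' (Subgroup.center (ULift.{v} φ.range))).comp θ
  have hψ : Function.Surjective ψ := (QuotientGroup.mk'_surjective _).comp hθ
  have hker : π.ker = ψ.ker := by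
    ext w
    have hcomm : ∀ a b, Commute (θ a) (θ b) ↔ Commute (φ a) (φ b) := fun a b => by
      rw [commute_iff_eq, commute_iff_eq, ← ULift.down_injective.eq_iff,
        ← Subtype.val_injective.eq_iff]
      rfl
    rw [MonoidHom.mem_ker, MonoidHom.mem_ker, h]
    change _ ↔ QuotientGroup.mk' _ (θ w) = 1
    rw [QuotientGroup.mk'_apply, QuotientGroup.eq_one_iff, Subgroup.mem_center_iff]
    refine ⟨fun hl g => ?_, fun hc l => (hcomm _ _).1 (hc _).symm⟩
    obtain ⟨u, rfl⟩ := hθ g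
    refine ((hcomm _ _).2 ?_).symm.eq
    induction u using FreeGroup.induction_on with
    | C1 => simp
    | of l => exact hl l
    | inv_of l hl' => rw [map_inv]; exact hl'.inv_right
    | mul a b ha hb => rw [map_mul]; exact ha.mul_right hb
  exact ⟨_, _, ⟨(QuotientGroup.quotientKerEquivOfSurjective π hπ).symm.trans
    ((QuotientGroup.quotientMulEquivOfEq hker).trans
      (QuotientGroup.quotientKerEquivOfSurjective ψ hψ))⟩⟩

/-! ### Necessity of the condition. -/

/-- In a group of class three: if `x ^ n` commutes with `y`, then `y ^ (2 n)` commutes with `x`. -/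
theorem commute_pow_two_mul {H : Type*} [Group H]
    (h3 : ∀ a b c d : H, Commute ⁅⁅a, b⁆, c⁆ d) (x y : H) (n : ℕ) (hn : Commute (x ^ n) y) :
    Commute (y ^ (2 * n)) x := by
  set c := ⁅x⁻¹, y⁻¹⁆ with hc
  set d := ⁅c⁻¹, x⁻¹⁆ with hd
  set e := ⁅c⁻¹, y⁻¹⁆ with he
  have hcent (z : H) (a b : H) : Commute ⁅⁅a, b⁆⁻¹, z⁆ = Commute ⁅⁅b, a⁆, z⁆ := by
    rw [commutatorElement_inv]
  have hdc : ∀ g, Commute d g := fun g => by rw [hd, hc, hcent]; exact h3 _ _ _ _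
  have hec : ∀ g, Commute e g := fun g => by rw [he, hc, hcent]; exact h3 _ _ _ _
  have hxy : x * y = y * (x * c) := by rw [hc, commutatorElement_def]; group
  have hcx : c * x = x * (c * d) := by
    rw [hd, commutatorElement_def]; group
  have hcy : c * y = y * (c * e) := by
    rw [he, commutatorElement_def]; group
  have hcxk : ∀ k : ℕ, c ^ k * x = x * (c ^ k * d ^ k) := fun k => by
    rw [← (hdc c).symm.mul_pow]
    exact (SemiconjBy.pow_right (show SemiconjBy x (c * d) c from hcx.symm) k).eq.symm
  have hcyk : ∀ k : ℕ, c ^ k * y = y * (c ^ k * e ^ k) := fun k => by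
    rw [← (hec c).symm.mul_pow]
    exact (SemiconjBy.pow_right (show SemiconjBy y (c * e) c from hcy.symm) k).eq.symm
  have hxck : ∀ k : ℕ, (x * c) ^ k = x ^ k * (c ^ k * d ^ k.choose 2) := fun k => by
    induction k with
    | zero => simp
    | succ k ih =>
      have h1 : d ^ k.choose 2 * (x * c) = x * c * d ^ k.choose 2 := ((hdc _).pow_left _).eq
      have h2 : d ^ k * c = c * d ^ k := ((hdc _).pow_left _).eq
      rw [pow_succ, ih, mul_assoc, mul_assoc, h1, ← mul_assoc (c ^ k), ← mul_assoc (c ^ k), hcxk,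
        Nat.choose_succ_succ' k 1, Nat.choose_one_right, pow_add _ k (k.choose _), pow_succ x k, pow_succ c k]
      simp only [mul_assoc]
      rw [← mul_assoc (d ^ k) c, h2, mul_assoc]
  have hxyk : ∀ k : ℕ, x * y ^ k = y ^ k * (x * (c ^ k * e ^ k.choose 2)) := fun k => by
    induction k with
    | zero => simp
    | succ k ih =>
      have h1 : e ^ k.choose 2 * y = y * e ^ k.choose 2 := ((hec _).pow_left _).eq
      have h2 : e ^ k * (c * e ^ k.choose 2) = c * (e ^ k * e ^ k.choose 2) := by
        rw [← mul_assoc, ((hec c).pow_left k).eq, mul_assoc]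
      have h3 : c * c ^ k = c ^ k * c := ((Commute.refl c).pow_right k).eq
      rw [pow_succ, ← mul_assoc, ih]
      simp only [mul_assoc]
      rw [h1, ← mul_assoc (c ^ k), hcyk, ← mul_assoc x, ← mul_assoc x, hxy,
        Nat.choose_succ_succ' k 1, Nat.choose_one_right, pow_add _ k (k.choose _), pow_succ c k, ← h3]
      simp only [mul_assoc]
  -- Conjugation by `y` carries `x` to `x * c` and fixes `x ^ n`. Hence `c ^ n` is a power of the
  -- central `d`, which forces `d ^ n = e ^ n = 1`.
  have hcn : c ^ n * d ^ n.choose 2 = 1 := by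
    have h1 : y * (x * c) ^ n = x ^ n * y :=
      (SemiconjBy.pow_right (show SemiconjBy y (x * c) x from hxy.symm) n).eq
    rw [hxck, hn.eq] at h1
    simpa using h1
  have hcn' : c ^ n = (d ^ n.choose 2)⁻¹ := eq_inv_of_mul_eq_one_left hcn
  have hcc : ∀ g, Commute (c ^ n) g := fun g => by
    rw [hcn']; exact ((hdc g).pow_left _).inv_left
  have hdn : d ^ n = 1 := by
    have h1 := hcxk n
    rw [(hcc x).eq] at h1
    simpa using h1
  have hen : e ^ n = 1 := by
    have h1 := hcyk n
    rw [(hcc y).eq] at h1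
    simpa using h1
  -- The factor 2 clears the denominator of `n.choose 2`: the exponent of `d` becomes `n * (n - 1)`,
  -- a multiple of `n`. Likewise `(2 * n).choose 2 = n * (2 * n - 1)`.
  have hc2 : c ^ (2 * n) = 1 := by
    rw [mul_comm, pow_mul, hcn', inv_pow, ← pow_mul, Nat.choose_two_right,
      Nat.div_mul_cancel (Nat.even_mul_pred_self n).two_dvd, pow_mul, hdn, one_pow, inv_one]
  have he2 : e ^ (2 * n).choose 2 = 1 := by
    rw [Nat.choose_two_right, mul_assoc, Nat.mul_div_cancel_left _ two_pos, pow_mul, hen, one_pow]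
  have h1 := hxyk (2 * n)
  rw [hc2, he2, mul_one, mul_one] at h1
  exact h1.symm

/-- The centralizer of `z` maps onto `H / Z(H)`, and altering an element by a central factor does
not affect whether it commutes with `z`. -/
theorem mem_center_of_commute_of_closure {H G ι : Type*} [Group H] [Group G]
    (e : G ≃* H ⧸ Subgroup.center H) {g : ι → G} (hg : Subgroup.closure (Set.range g) = ⊤)
    {y : ι → H} (hy : ∀ i, (y i : H ⧸ Subgroup.center H) = e (g i)) {z : H}
    (hz : ∀ i, Commute z (y i)) : z ∈ Subgroup.center H := by
  have h : Subgroup.closure (Set.range g) ≤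
      ((Subgroup.centralizer {z}).map (QuotientGroup.mk' (Subgroup.center H))).comap
        e.toMonoidHom := by
    rw [Subgroup.closure_le]
    rintro _ ⟨i, rfl⟩
    exact ⟨y i, Subgroup.mem_centralizer_singleton_iff.2 (hz i).symm.eq, hy i⟩
  rw [hg] at h
  rw [Subgroup.mem_center_iff]
  intro a
  obtain ⟨b, hb, hba⟩ := h (Subgroup.mem_top (e.symm (a : H ⧸ Subgroup.center H)))
  change (b : H ⧸ Subgroup.center H) = e (e.symm _) at hba
  rw [MulEquiv.apply_symm_apply, QuotientGroup.eq] at hba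
  have h1 := Subgroup.mem_center_iff.1 hba z
  have h2 := Subgroup.mem_centralizer_singleton_iff.1 hb
  calc a * z = b * (b⁻¹ * a * z) := by group
    _ = z * a := by rw [← h1, ← mul_assoc, h2]; group

theorem NilpotentProduct.le_add_one_of_isCapable {r : ℕ}
    (C : Fin r → Type u) [∀ i, Group (C i)]
    (x : (i : Fin r) → C i) (hx : ∀ i, Subgroup.zpowers (x i) = ⊤)
    (α : Fin r → ℕ) (hord : ∀ i, orderOf (x i) = 2 ^ α i)
    (hpos : ∀ i, 1 ≤ α i) (hmono : Monotone α) {last : Fin r}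
    (hcap : IsCapable.{u, v} (NilpotentProduct 2 C)) :
    1 < r ∧ ∀ prev, (∀ l, l ≠ last → l ≤ prev) → α last ≤ α prev + 1 := by
  obtain ⟨H, _, ⟨e⟩⟩ := hcap
  choose y hy using fun i => QuotientGroup.mk_surjective (e (incl i (x i)))
  have hkey : ∀ n : ℕ, (∀ l, Commute (y last ^ n) (y l)) → 2 ^ α last ∣ n := fun n hn => by
    have h1 := mem_center_of_commute_of_closure e (closure_incl_eq_top hx) hy hn
    rw [← QuotientGroup.eq_one_iff, QuotientGroup.mk_pow, hy, ← map_pow, ← map_pow,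
      map_eq_one_iff e e.injective, map_eq_one_iff _ (incl_injective_of_comm last ?_)] at h1
    · rw [← hord]; exact orderOf_dvd_of_pow_eq_one h1
    · intro a b
      obtain ⟨s, rfl⟩ : a ∈ Subgroup.zpowers (x last) := by simp [hx]
      obtain ⟨t, rfl⟩ : b ∈ Subgroup.zpowers (x last) := by simp [hx]
      exact ((Commute.refl (x last)).zpow_zpow s t).eq
  have hr1 : 1 < r := by
    by_contra hr'
    have h1 : 2 ^ α last ∣ 1 := hkey 1 fun l => by
      have : l = last := by have := l.2; have := last.2; omega
      rw [this, pow_one]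
    have h2 := hpos last
    rw [Nat.dvd_one, Nat.pow_eq_one] at h1
    omega
  refine ⟨hr1, fun prev hprev => ?_⟩
  have h3 : ∀ a b c d : H, Commute ⁅⁅a, b⁆, c⁆ d := fun a b c d => by
    have h1 : ((⁅⁅a, b⁆, c⁆ : H) : H ⧸ Subgroup.center H) = 1 := by
      change QuotientGroup.mk' _ _ = _
      rw [map_commutatorElement, map_commutatorElement, ← e.apply_symm_apply (QuotientGroup.mk' _ a),
        ← e.apply_symm_apply (QuotientGroup.mk' _ b), ← e.apply_symm_apply (QuotientGroup.mk' _ c),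
        ← map_commutatorElement, ← map_commutatorElement, commutator_commutator_eq_one, map_one]
    rw [QuotientGroup.eq_one_iff] at h1
    exact (Subgroup.mem_center_iff.1 h1 d).symm
  have h2 : 2 ^ α last ∣ 2 * 2 ^ α prev := by
    refine hkey _ fun l => ?_
    by_cases hl : l = last
    · rw [hl]; exact (Commute.refl _).pow_left _
    refine commute_pow_two_mul h3 _ _ _ ?_
    have hle : α l ≤ α prev := hmono (hprev l hl)
    have h4 : y l ^ 2 ^ α prev ∈ Subgroup.center H := by
      rw [← QuotientGroup.eq_one_iff, QuotientGroup.mk_pow, hy, ← map_pow, ← map_pow]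
      have : x l ^ 2 ^ α prev = 1 := orderOf_dvd_iff_pow_eq_one.1 (by
        rw [hord]; exact pow_dvd_pow 2 hle)
      rw [this, map_one, map_one]
    exact (Subgroup.mem_center_iff.1 h4 _).symm
  rw [mul_comm, ← pow_succ, Nat.pow_dvd_pow_iff_le_right (by norm_num)] at h2
  exact h2

/-! ### The class-three test groups. -/

/-- The group of the permutations `(t, s) ↦ (t + p, s + q t² + k t + l)` of `R × R`. -/
@[ext]
structure QuadGroup (R : Type*) where
  p : R
  q : R
  k : R
  l : R

namespace QuadGroup

variable {R : Type*} [CommRing R]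

instance : Mul (QuadGroup R) :=
  ⟨fun a b => ⟨a.p + b.p, a.q + b.q, a.k + b.k + 2 * a.q * b.p,
    a.l + b.l + a.k * b.p + a.q * b.p ^ 2⟩⟩

instance : One (QuadGroup R) := ⟨⟨0, 0, 0, 0⟩⟩

instance : Inv (QuadGroup R) :=
  ⟨fun a => ⟨-a.p, -a.q, -a.k + 2 * a.q * a.p, -a.l + a.k * a.p - a.q * a.p ^ 2⟩⟩

@[simp] theorem mul_p (a b : QuadGroup R) : (a * b).p = a.p + b.p := rfl
@[simp] theorem mul_q (a b : QuadGroup R) : (a * b).q = a.q + b.q := rfl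
@[simp] theorem mul_k (a b : QuadGroup R) : (a * b).k = a.k + b.k + 2 * a.q * b.p := rfl
@[simp] theorem mul_l (a b : QuadGroup R) :
    (a * b).l = a.l + b.l + a.k * b.p + a.q * b.p ^ 2 := rfl
@[simp] theorem one_p : (1 : QuadGroup R).p = 0 := rfl
@[simp] theorem one_q : (1 : QuadGroup R).q = 0 := rfl
@[simp] theorem one_k : (1 : QuadGroup R).k = 0 := rfl
@[simp] theorem one_l : (1 : QuadGroup R).l = 0 := rfl
@[simp] theorem inv_p (a : QuadGroup R) : a⁻¹.p = -a.p := rfl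
@[simp] theorem inv_q (a : QuadGroup R) : a⁻¹.q = -a.q := rfl
@[simp] theorem inv_k (a : QuadGroup R) : a⁻¹.k = -a.k + 2 * a.q * a.p := rfl
@[simp] theorem inv_l (a : QuadGroup R) : a⁻¹.l = -a.l + a.k * a.p - a.q * a.p ^ 2 := rfl

instance : Group (QuadGroup R) :=
  Group.ofLeftAxioms (by intro a b c; ext <;> simp <;> ring) (by intro a; ext <;> simp)
    (by intro a; ext <;> simp; ring)

theorem commute_commutator_commutator (a b c d : QuadGroup R) : Commute ⁅⁅a, b⁆, c⁆ d := by
  have hp : ∀ a b : QuadGroup R, ⁅a, b⁆.p = 0 := fun a b => by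
    simp [commutatorElement_def]
  have hq : ∀ a b : QuadGroup R, ⁅a, b⁆.q = 0 := fun a b => by
    simp [commutatorElement_def]
  have hk : ⁅⁅a, b⁆, c⁆.k = 0 := by
    have h1 := hp a b
    have h2 := hq a b
    rw [commutatorElement_def]
    simp only [mul_k, mul_q, inv_k, inv_p, inv_q, h1, h2]
    ring
  rw [commute_iff_eq]
  ext <;> simp [hp, hq, hk, add_comm]

/-- The generator `(t, s) ↦ (t + 1, s)`. -/
def shift : QuadGroup R := ⟨1, 0, 0, 0⟩

/-- The generator `(t, s) ↦ (t + c, s + t²)`. -/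
def square (c : R) : QuadGroup R := ⟨c, 1, 0, 0⟩

theorem commute_generators {a : QuadGroup R} {c : R} (h1 : Commute a shift)
    (h2 : Commute a (square c)) : 2 * a.q = 0 ∧ a.k + a.q = 0 ∧ 2 * a.p = 0 := by
  have e1 := congrArg k h1.eq
  have e2 := congrArg l h1.eq
  have e3 := congrArg k h2.eq
  simp only [shift, square, mul_k, mul_l] at e1 e2 e3
  exact ⟨by linear_combination e1, by linear_combination e2,
    by linear_combination c * e1 - e3⟩

theorem commute_of_forall {a : QuadGroup R} (hq : 2 * a.q = 0) (hk : a.k + a.q = 0)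
    (hp : 2 * a.p = 0) (hp2 : a.p ^ 2 = 0) (c : R) (hc : c * (c - 1) * a.q = 0) :
    Commute a shift ∧ Commute a (square c) := by
  constructor <;> rw [commute_iff_eq] <;> ext
  · simp [add_comm]
  · simp [add_comm]
  · simp only [shift, mul_k]; linear_combination hq
  · simp only [shift, mul_l]; linear_combination hk
  · simp [add_comm]
  · simp [add_comm]
  · simp only [square, mul_k]; linear_combination c * hq - hp
  · simp only [square, mul_l]; linear_combination c * hk + hc - hp2

theorem zpow_p (a : QuadGroup R) (n : ℤ) : (a ^ n).p = n * a.p := by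
  induction n using Int.induction_on with
  | zero => simp
  | succ n ih => rw [zpow_add_one, mul_p, ih]; push_cast; ring
  | pred n ih => rw [zpow_sub_one, mul_p, ih, inv_p]; push_cast; ring

theorem zpow_q (a : QuadGroup R) (n : ℤ) : (a ^ n).q = n * a.q := by
  induction n using Int.induction_on with
  | zero => simp
  | succ n ih => rw [zpow_add_one, mul_q, ih]; push_cast; ring
  | pred n ih => rw [zpow_sub_one, mul_q, ih, inv_q]; push_cast; ring

theorem zpow_k (a : QuadGroup R) (n : ℤ) : (a ^ n).k = n * a.k + n * (n - 1) * a.q * a.p := by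
  induction n using Int.induction_on with
  | zero => simp
  | succ n ih => rw [zpow_add_one, mul_k, ih, zpow_q]; push_cast; ring
  | pred n ih => rw [zpow_sub_one, mul_k, ih, zpow_q, inv_k, inv_p]; push_cast; ring

end QuadGroup

/-! ### Commutators in class two, and factoring through the nilpotent product. -/

/-- The subgroup on the right is central, hence normal, and modulo it the generators commute. -/
theorem commutator_le_closure_commutator_generators {G ι : Type*} [Group G] [LinearOrder ι]
    (h2 : ∀ a b c : G, ⁅⁅a, b⁆, c⁆ = 1) {g : ι → G} (hg : Subgroup.closure (Set.range g) = ⊤) :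
    commutator G ≤ Subgroup.closure {z | ∃ i j, i < j ∧ z = ⁅g j, g i⁆} := by
  set S := Subgroup.closure {z | ∃ i j, i < j ∧ z = ⁅g j, g i⁆} with hS
  have hSc : S ≤ Subgroup.center G := by
    rw [hS, Subgroup.closure_le]
    rintro _ ⟨i, j, -, rfl⟩
    exact Subgroup.mem_center_iff.2 fun a =>
      (commutatorElement_eq_one_iff_mul_comm.1 (h2 (g j) (g i) a)).symm
  have hSn : S.Normal := ⟨fun n hn a => by
    rwa [Subgroup.mem_center_iff.1 (hSc hn) a, mul_inv_cancel_right]⟩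
  have hgen : ∀ i j, Commute (g i : G ⧸ S) (g j) := by
    have h : ∀ i j, i < j → Commute (g j : G ⧸ S) (g i) := fun i j hij => by
      rw [← commutatorElement_eq_one_iff_commute]
      have h1 : ⁅g j, g i⁆ ∈ S := Subgroup.subset_closure ⟨i, j, hij, rfl⟩
      rwa [← QuotientGroup.eq_one_iff, ← QuotientGroup.mk'_apply, map_commutatorElement] at h1
    intro i j
    rcases lt_trichotomy i j with hij | rfl | hij
    · exact (h i j hij).symm
    · exact Commute.refl _
    · exact h j i hij
  have hcl : ∀ b : G ⧸ S, (∀ j, Commute (g j : G ⧸ S) b) → ∀ a : G, Commute (a : G ⧸ S) b := by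
    intro b hb a
    have ha : a ∈ Subgroup.closure (Set.range g) := hg ▸ Subgroup.mem_top a
    induction ha using Subgroup.closure_induction with
    | mem _ h => obtain ⟨j, rfl⟩ := h; exact hb j
    | one => exact Commute.one_left b
    | mul u w _ _ hu hw => exact hu.mul_left hw
    | inv u _ hu => exact hu.inv_left
  refine hSn.quotient_commutative_iff_commutator_le.1 ⟨⟨fun a b => ?_⟩⟩
  obtain ⟨a, rfl⟩ := QuotientGroup.mk_surjective a
  obtain ⟨b, rfl⟩ := QuotientGroup.mk_surjective b
  exact hcl b (fun j => (hcl _ (fun i => hgen i j) b).symm) a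

theorem zpow_eq_one_of_commutator {G : Type*} [Group G] (h2 : ∀ a b c : G, ⁅⁅a, b⁆, c⁆ = 1)
    {a b : G} {m : ℕ} (hb : b ^ m = 1) {n : ℤ} (hn : (m : ℤ) ∣ n) : ⁅a, b⁆ ^ n = 1 := by
  obtain ⟨k, rfl⟩ := hn
  have h : ∀ i : ℕ, a * b ^ i * a⁻¹ = ⁅a, b⁆ ^ i * b ^ i := fun i => by
    rw [← conj_pow, ← (commutatorElement_eq_one_iff_commute.1 (h2 a b b)).mul_pow,
      commutatorElement_def]
    group
  have h1 := h m
  rw [hb, mul_one, mul_one, mul_inv_cancel] at h1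
  rw [zpow_mul, zpow_natCast, ← h1, one_zpow]

/-- The image of the free group modulo its centre has class at most two, and there the order of each
generator divides that of `x i`; so the map to it factors through the nilpotent product. -/
theorem NilpotentProduct.commute_lift_of_eq_one {ι : Type*} {C : ι → Type*} [∀ i, Group (C i)]
    {x : (i : ι) → C i} (hx : ∀ i, Subgroup.zpowers (x i) = ⊤) {K : Type*} [Group K]
    (h3 : ∀ a b c d : K, Commute ⁅⁅a, b⁆, c⁆ d) {g : ι → K}
    (hg : ∀ i l, Commute (g i ^ orderOf (x i)) (g l)) {w : FreeGroup ι}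
    (hw : FreeGroup.lift (fun i => (incl i (x i) : NilpotentProduct 2 C)) w = 1) (l : ι) :
    Commute (FreeGroup.lift g w) (g l) := by
  set φ := FreeGroup.lift g
  have hcen : ∀ a : K, (∀ l, Commute a (g l)) → ∀ u, Commute a (φ u) := fun a ha u => by
    induction u using FreeGroup.induction_on with
    | C1 => simp
    | of l => simpa [φ] using ha l
    | inv_of l h => rw [map_inv]; exact h.inv_right
    | mul a b ha hb => rw [map_mul]; exact ha.mul_right hb
  have hmem : ∀ a : φ.range, a ∈ Subgroup.center φ.range ↔ ∀ l, Commute (a : K) (g l) := by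
    intro a
    rw [Subgroup.mem_center_iff]
    refine ⟨fun h l => ?_, fun h b => ?_⟩
    · have h1 := congrArg Subtype.val (h ⟨g l, FreeGroup.of l, by simp [φ]⟩)
      exact h1.symm
    · obtain ⟨u, hu⟩ := b.2
      refine Subtype.ext ?_
      have h1 := hcen a h u
      rw [hu] at h1
      exact h1.symm
  let ρ := (QuotientGroup.mk' (Subgroup.center φ.range)).comp φ.rangeRestrict
  have hρ : Function.Surjective ρ :=
    (QuotientGroup.mk'_surjective _).comp φ.rangeRestrict_surjective
  have hρ1 : ∀ w, ρ w = 1 ↔ ∀ l, Commute (φ w) (g l) := fun w => by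
    rw [← show ((φ.rangeRestrict w : φ.range) : K) = φ w from rfl, ← hmem,
      ← QuotientGroup.eq_one_iff]
    rfl
  have hQ : ∀ a b c : φ.range ⧸ Subgroup.center φ.range, ⁅⁅a, b⁆, c⁆ = 1 := fun a b c => by
    obtain ⟨a, rfl⟩ := hρ a
    obtain ⟨b, rfl⟩ := hρ b
    obtain ⟨c, rfl⟩ := hρ c
    rw [← map_commutatorElement, ← map_commutatorElement, hρ1]
    intro l
    rw [map_commutatorElement, map_commutatorElement]
    exact h3 _ _ _ _
  have hord : ∀ i, orderOf (ρ (FreeGroup.of i)) ∣ orderOf (x i) := fun i => by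
    rw [orderOf_dvd_iff_pow_eq_one, ← map_pow, hρ1]
    intro l
    rw [map_pow, FreeGroup.lift_apply_of]
    exact hg i l
  have hx' : ∀ i, ∀ a, a ∈ Subgroup.zpowers (x i) := fun i a => by simp [hx]
  obtain ⟨F, hF⟩ := exists_hom hQ fun i => monoidHomOfForallMemZpowers (hx' i) (hord i)
  have hFρ : F.comp (FreeGroup.lift fun i => incl i (x i)) = ρ := by
    ext i
    rw [MonoidHom.comp_apply, FreeGroup.lift_apply_of, hF, monoidHomOfForallMemZpowers_apply_gen]
  refine (hρ1 w).1 ?_ l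
  rw [← hFρ, MonoidHom.comp_apply, hw, map_one]

theorem ZMod.two_pow_eq_zero {a n : ℕ} (h : a < n) : (2 : ZMod (2 * 2 ^ a)) ^ n = 0 := by
  have h1 : ((2 ^ n : ℕ) : ZMod (2 * 2 ^ a)) = 0 := by
    rw [ZMod.natCast_eq_zero_iff, mul_comm, ← pow_succ]
    exact pow_dvd_pow 2 h
  exact_mod_cast h1

theorem ZMod.two_mul_intCast_eq_zero {a : ℕ} {z : ℤ} :
    2 * (z : ZMod (2 * 2 ^ a)) = 0 ↔ (2 : ℤ) ^ a ∣ z := by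
  have h1 : ((2 * z : ℤ) : ZMod (2 * 2 ^ a)) = 0 ↔ (2 : ℤ) ^ a ∣ z := by
    rw [ZMod.intCast_zmod_eq_zero_iff_dvd]
    push_cast
    exact mul_dvd_mul_iff_left two_ne_zero
  rw [← h1]
  push_cast
  rfl

/-! ### Homomorphisms to the test groups and the exponents they detect. -/

namespace QuadGroup

variable {r : ℕ} (α : Fin r → ℕ)

/-- The images of the generators in the test group attached to the pair `i < j`. -/
def pairGen (i j : Fin r) (c : Bool) (l : Fin r) : QuadGroup (ZMod (2 * 2 ^ α i)) :=
  if l = i then shift else if l = j then square (if c then 1 else 0) else 1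

theorem commute_pairGen_iff {i j : Fin r} (hij : i < j) {c : Bool}
    {a : QuadGroup (ZMod (2 * 2 ^ α i))} :
    (∀ l, Commute a (pairGen α i j c l)) ↔
      Commute a shift ∧ Commute a (square (if c then 1 else 0)) := by
  refine ⟨fun h => ⟨?_, ?_⟩, fun h l => ?_⟩
  · simpa [pairGen] using h i
  · simpa [pairGen, hij.ne'] using h j
  · unfold pairGen
    split_ifs
    · exact h.1
    · simpa [*] using h.2
    · simpa [*] using h.2
    · exact Commute.one_right a

theorem commute_pairGen_pow (hpos : ∀ i, 1 ≤ α i) (hmono : Monotone α) {i j : Fin r} (hij : i < j)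
    {c : Bool} (hc : c = true ∨ α i < α j) (l l' : Fin r) :
    Commute (pairGen α i j c l ^ 2 ^ α l) (pairGen α i j c l') := by
  revert l'
  rw [commute_pairGen_iff α hij]
  have hij' := hmono hij.le
  have hi := hpos i
  have e0 : ((1 : ZMod (2 * 2 ^ α i)) * (1 - 1)) = 0 := by ring
  unfold pairGen
  rw [← zpow_natCast]
  by_cases hli : l = i
  · subst hli
    have e1 : (2 : ZMod (2 * 2 ^ α l)) * 2 ^ α l = 0 :=
      (pow_succ' _ _).symm.trans (ZMod.two_pow_eq_zero (by omega))
    have e2 : ((2 : ZMod (2 * 2 ^ α l)) ^ α l) ^ 2 = 0 :=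
      (pow_mul _ _ _).symm.trans (ZMod.two_pow_eq_zero (by omega))
    rw [if_pos rfl]
    apply commute_of_forall <;> simp [zpow_p, zpow_q, zpow_k, shift, e1, e2]
  rw [if_neg hli]
  by_cases hlj : l = j
  · subst hlj
    have e1 : (2 : ZMod (2 * 2 ^ α i)) * 2 ^ α l = 0 :=
      (pow_succ' _ _).symm.trans (ZMod.two_pow_eq_zero (by omega))
    have e2 : ((2 : ZMod (2 * 2 ^ α i)) ^ α l) ^ 2 = 0 :=
      (pow_mul _ _ _).symm.trans (ZMod.two_pow_eq_zero (by omega))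
    rw [if_pos rfl]
    cases c with
    | true =>
      apply commute_of_forall <;> simp [zpow_p, zpow_q, zpow_k, square, e1, e2]
      -- For `c = true` the power `n = 2 ^ α l` has `k + q = n * (n - 1) + n = n ^ 2`, which
      -- vanishes. For `c = false` it is `n` itself, whence the requirement `α i < α j`.
      linear_combination e2
    | false =>
      have e3 : (2 : ZMod (2 * 2 ^ α i)) ^ α l = 0 := ZMod.two_pow_eq_zero (by simpa using hc)
      apply commute_of_forall <;> simp [zpow_p, zpow_q, zpow_k, square, e3]
  · rw [if_neg hlj, one_zpow]
    exact ⟨Commute.one_left _, Commute.one_left _⟩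

/-- The homomorphism from the free group to the test group attached to the pair `i < j`. -/
def pairHom (i j : Fin r) (c : Bool) : FreeGroup (Fin r) →* QuadGroup (ZMod (2 * 2 ^ α i)) :=
  FreeGroup.lift (pairGen α i j c)

/-- The coordinates `p` and `q` are additive, so they depend only on the exponent sums of the word.
-/
theorem exists_exponents {G : Type*} [CommGroup G] (g : Fin r → G) (w : FreeGroup (Fin r)) :
    ∃ a : Fin r → ℤ, FreeGroup.lift g w = ∏ l, g l ^ a l ∧ ∀ i j, i < j → ∀ c,
      (pairHom α i j c w).p = a i + (if c then 1 else 0) * a j ∧ (pairHom α i j c w).q = a j := by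
  have hof : ∀ l : Fin r, ∃ a : Fin r → ℤ, FreeGroup.lift g (FreeGroup.of l) = ∏ l, g l ^ a l ∧
      ∀ i j, i < j → ∀ c, (pairHom α i j c (FreeGroup.of l)).p =
        a i + (if c then 1 else 0) * a j ∧ (pairHom α i j c (FreeGroup.of l)).q = a j := by
    intro l
    refine ⟨Pi.single l 1, ?_, fun i j hij c => ?_⟩
    · rw [Finset.prod_eq_single l (fun b _ hb => by simp [hb]) (by simp)]
      simp
    · simp only [pairHom, FreeGroup.lift_apply_of, pairGen]
      split_ifs with h1 h2 <;> simp_all [shift, square, hij.ne, hij.ne', eq_comm]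
  have hinv : ∀ w : FreeGroup (Fin r), (∃ a : Fin r → ℤ, FreeGroup.lift g w = ∏ l, g l ^ a l ∧
      ∀ i j, i < j → ∀ c, (pairHom α i j c w).p =
        a i + (if c then 1 else 0) * a j ∧ (pairHom α i j c w).q = a j) →
      ∃ a : Fin r → ℤ, FreeGroup.lift g w⁻¹ = ∏ l, g l ^ a l ∧
      ∀ i j, i < j → ∀ c, (pairHom α i j c w⁻¹).p =
        a i + (if c then 1 else 0) * a j ∧ (pairHom α i j c w⁻¹).q = a j := by
    rintro w ⟨a, ha, hpq⟩
    refine ⟨-a, by simp [ha], fun i j hij c => ?_⟩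
    simp only [map_inv, inv_p, inv_q, hpq i j hij c, Pi.neg_apply, Int.cast_neg, and_true]
    ring
  induction w using FreeGroup.induction_on with
  | C1 => exact ⟨0, by simp, by simp⟩
  | of l => exact hof l
  | inv_of l h => exact hinv _ (hof l)
  | mul u w hu hw =>
    obtain ⟨a, ha, hpq⟩ := hu
    obtain ⟨b, hb, hpq'⟩ := hw
    refine ⟨a + b, by simp [ha, hb, zpow_add, Finset.prod_mul_distrib], fun i j hij c => ?_⟩
    simp only [map_mul, mul_p, mul_q, hpq i j hij c, hpq' i j hij c, Pi.add_apply, Int.cast_add,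
      and_true]
    ring

open scoped IsMulCommutative in
-- The commutator of the `j`-th and `i`-th generators has `k = 2` in the test groups of `(i, j)` and
-- `k = 0` in those of other pairs. The same `b` serves both values of `c`, which allows the two to
-- be compared.
theorem exists_commutator_exponents {G : Type*} [Group G] (h2 : ∀ a b c : G, ⁅⁅a, b⁆, c⁆ = 1)
    {g : Fin r → G} (hg : Subgroup.closure (Set.range g) = ⊤) (hgo : ∀ i, g i ^ 2 ^ α i = 1)
    {z : G} (hz : z ∈ commutator G) :
    ∃ (w : FreeGroup (Fin r)) (b : Fin r × Fin r → ℤ), FreeGroup.lift g w = z ∧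
      ((∀ i j, i < j → (2 : ℤ) ^ α i ∣ b (i, j)) → z = 1) ∧
      ∀ i j, i < j → ∀ c, (pairHom α i j c w).p = 0 ∧ (pairHom α i j c w).q = 0 ∧
        (pairHom α i j c w).k = 2 * b (i, j) := by
  have hc : ∀ a b : G, ⁅a, b⁆ ∈ Subgroup.center G := fun a b => Subgroup.mem_center_iff.2 fun d =>
    (commutatorElement_eq_one_iff_mul_comm.1 (h2 a b d)).symm
  let κ : Fin r × Fin r → Subgroup.center G := fun t => ⟨⁅g t.2, g t.1⁆, hc _ _⟩
  suffices h : ∃ (w : FreeGroup (Fin r)) (b : Fin r × Fin r → ℤ), FreeGroup.lift g w = z ∧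
      z = ((∏ t with t.1 < t.2, κ t ^ b t : Subgroup.center G) : G) ∧
      ∀ i j, i < j → ∀ c, (pairHom α i j c w).p = 0 ∧ (pairHom α i j c w).q = 0 ∧
        (pairHom α i j c w).k = 2 * b (i, j) by
    obtain ⟨w, b, hw, hb, hpq⟩ := h
    refine ⟨w, b, hw, fun hd => ?_, hpq⟩
    rw [hb, Finset.prod_eq_one, Subgroup.coe_one]
    rintro ⟨i, j⟩ ht
    refine Subtype.ext ?_
    rw [Subgroup.coe_zpow, Subgroup.coe_one]
    exact zpow_eq_one_of_commutator h2 (hgo i) (by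
      push_cast; exact hd i j (by simpa using ht))
  have hz' := commutator_le_closure_commutator_generators h2 hg hz
  clear hz
  induction hz' using Subgroup.closure_induction with
  | one => exact ⟨1, 0, by simp, by simp, by simp⟩
  | mul y z _ _ hy hz =>
    obtain ⟨u, a, hu, ha, hpa⟩ := hy
    obtain ⟨w, b, hw, hb, hpb⟩ := hz
    refine ⟨u * w, a + b, by simp [hu, hw], ?_, fun i j hij c => ?_⟩
    · rw [ha, hb, ← Subgroup.coe_mul, ← Finset.prod_mul_distrib]
      simp only [Pi.add_apply, zpow_add]
    · obtain ⟨h1, h2, h3⟩ := hpa i j hij c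
      obtain ⟨h4, h5, h6⟩ := hpb i j hij c
      simp [h1, h2, h3, h4, h5, h6, mul_add]
  | inv y _ hy =>
    obtain ⟨u, a, hu, ha, hpa⟩ := hy
    refine ⟨u⁻¹, -a, by simp [hu], ?_, fun i j hij c => ?_⟩
    · rw [ha, ← Subgroup.coe_inv, ← Finset.prod_inv_distrib]
      simp only [Pi.neg_apply, zpow_neg]
    · obtain ⟨h1, h2, h3⟩ := hpa i j hij c
      simp [h1, h2, h3]
  | mem z hz =>
    obtain ⟨i', j', hij', rfl⟩ := hz
    refine ⟨⁅FreeGroup.of j', FreeGroup.of i'⁆, Pi.single (i', j') 1, ?_, ?_, fun i j hij c => ?_⟩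
    · rw [map_commutatorElement, FreeGroup.lift_apply_of, FreeGroup.lift_apply_of]
    · rw [Finset.prod_eq_single (i', j') (fun b _ hb => by simp [hb]) (by simp [hij'])]
      simp [κ]
    · rw [map_commutatorElement]
      simp only [pairHom, FreeGroup.lift_apply_of, commutatorElement_def]
      refine ⟨by simp, by simp, ?_⟩
      by_cases h : i' = i ∧ j' = j
      · obtain ⟨rfl, rfl⟩ := h
        simp [pairGen, hij.ne', shift, square]
      · have h1 : (Pi.single (i', j') 1 : Fin r × Fin r → ℤ) (i, j) = 0 := by
          rw [Pi.single_apply, if_neg]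
          rw [Prod.mk.injEq]
          exact fun h' => h ⟨h'.1.symm, h'.2.symm⟩
        rw [h1]
        by_cases hi : i' = i
        · subst hi
          have hj : j' ≠ j := fun h' => h ⟨rfl, h'⟩
          simp [pairGen, hij'.ne', hj]
        · by_cases hj : i' = j
          · subst hj
            simp [pairGen, hij'.ne', (hij.trans hij').ne']
          · simp [pairGen, hi, hj]

end QuadGroup

/-! ### Sufficiency of the condition. -/

namespace QuadGroup

variable {r : ℕ} {α : Fin r → ℕ}

/-- The image of `w` in every test group is central in the image of the free group. -/
def TestCentral (α : Fin r → ℕ) (w : FreeGroup (Fin r)) : Prop :=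
  ∀ i j, i < j → ∀ c : Bool, (c = true ∨ α i < α j) →
    ∀ l, Commute (pairHom α i j c w) (pairGen α i j c l)

theorem TestCentral.mul {u w : FreeGroup (Fin r)} (hu : TestCentral α u) (hw : TestCentral α w) :
    TestCentral α (u * w) := fun i j hij c hc l => by
  rw [map_mul]; exact (hu i j hij c hc l).mul_left (hw i j hij c hc l)

theorem TestCentral.eqs {w : FreeGroup (Fin r)} (hw : TestCentral α w) {i j : Fin r} (hij : i < j)
    {c : Bool} (hc : c = true ∨ α i < α j) :
    2 * (pairHom α i j c w).q = 0 ∧ (pairHom α i j c w).k + (pairHom α i j c w).q = 0 ∧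
      2 * (pairHom α i j c w).p = 0 :=
  have h := (commute_pairGen_iff α hij).1 (hw i j hij c hc)
  commute_generators h.1 h.2

theorem testCentral_iff (w : FreeGroup (Fin r)) :
    TestCentral α w ↔ ∀ l, Commute
      (MonoidHom.pi (fun t : {t : Fin r × Fin r × Bool //
        t.1 < t.2.1 ∧ (t.2.2 = true ∨ α t.1 < α t.2.1)} => pairHom α t.1.1 t.1.2.1 t.1.2.2) w)
      (MonoidHom.pi (fun t : {t : Fin r × Fin r × Bool //
        t.1 < t.2.1 ∧ (t.2.2 = true ∨ α t.1 < α t.2.1)} => pairHom α t.1.1 t.1.2.1 t.1.2.2)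
        (FreeGroup.of l)) := by
  refine ⟨fun h l => funext fun t => ?_, fun h i j hij c hc l => ?_⟩
  · simpa [pairHom] using (h _ _ t.2.1 _ t.2.2 l).eq
  · simpa [pairHom, commute_iff_eq] using congrFun (h l).eq ⟨(i, j, c), hij, hc⟩

/-- If the image of `w` in every test group is central and the last two orders differ by a factor
at most two, then `w` lies in the kernel of any map to a group of class two whose generators
have the given orders. -/
theorem TestCentral.lift_eq_one (hpos : ∀ i, 1 ≤ α i) (hmono : Monotone α) {G : Type*} [Group G]
    (h2 : ∀ a b c : G, ⁅⁅a, b⁆, c⁆ = 1) {g : Fin r → G}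
    (hg : Subgroup.closure (Set.range g) = ⊤) (hgo : ∀ i, g i ^ 2 ^ α i = 1)
    (hker : ∀ w, FreeGroup.lift g w = 1 → TestCentral α w)
    {last prev : Fin r} (hlast : ∀ l, l ≠ last → l < last) (hpl : prev < last)
    (hα : α last ≤ α prev + 1) {w : FreeGroup (Fin r)} (hw : TestCentral α w) :
    FreeGroup.lift g w = 1 := by
  have hgz : ∀ i, ∀ n : ℤ, (2 : ℤ) ^ α i ∣ n → g i ^ n = 1 := fun i n hn => by
    obtain ⟨k, rfl⟩ := hn
    rw [zpow_mul]
    have : g i ^ ((2 : ℤ) ^ α i) = 1 := by exact_mod_cast hgo i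
    rw [this, one_zpow]
  -- Centrality in the test groups depends only on the image in `G`, so `w` may be replaced by a
  -- word in normal form.
  have htrans : ∀ u, FreeGroup.lift g u = FreeGroup.lift g w → TestCentral α u := fun u hu => by
    have h := hw.mul (hker (w⁻¹ * u) (by simp [hu]))
    rwa [mul_inv_cancel_left] at h
  obtain ⟨a, ha, hpq⟩ := exists_exponents α (fun l => Abelianization.of (g l)) w
  have hcomp : ∀ u, FreeGroup.lift (fun l => Abelianization.of (g l)) u =
      Abelianization.of (FreeGroup.lift g u) := by
    intro u
    rw [← MonoidHom.comp_apply]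
    congr 1
    ext i
    simp
  have hal : ∀ l, l ≠ last → (2 : ℤ) ^ α l ∣ a l ∧ (2 : ℤ) ^ α l ∣ a last := by
    intro l hl
    obtain ⟨h1, -, h3⟩ := hw.eqs (hlast l hl) (c := true) (Or.inl rfl)
    obtain ⟨hp, hq⟩ := hpq l last (hlast l hl) true
    rw [hq] at h1
    rw [hp, if_pos rfl, one_mul, mul_add, h1, add_zero] at h3
    exact ⟨ZMod.two_mul_intCast_eq_zero.1 h3, ZMod.two_mul_intCast_eq_zero.1 h1⟩
  have hab : Abelianization.of (FreeGroup.lift g w) = Abelianization.of (g last ^ a last) := by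
    rw [← hcomp, ha, Finset.prod_eq_single last _ (by simp), map_zpow]
    intro l _ hl
    rw [← map_zpow, hgz l _ (hal l hl).1, map_one]
  have hcom : (g last ^ a last)⁻¹ * FreeGroup.lift g w ∈ commutator G := by
    rw [← Abelianization.ker_of, MonoidHom.mem_ker, map_mul, map_inv, hab, inv_mul_cancel]
  obtain ⟨u, b, hu, hb1, hb⟩ := exists_commutator_exponents α h2 hg hgo hcom
  have hu' : FreeGroup.lift g (FreeGroup.of last ^ a last * u) = FreeGroup.lift g w := by
    rw [map_mul, hu, map_zpow, FreeGroup.lift_apply_of, mul_inv_cancel_left]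
  have hkq : ∀ c : Bool, (c = true ∨ α prev < α last) →
      (a last * (a last - 1) * (if c then 1 else 0) + 2 * b (prev, last) + a last :
        ZMod (2 * 2 ^ α prev)) = 0 := by
    intro c hc
    obtain ⟨-, h, -⟩ := (htrans _ hu').eqs hpl hc
    obtain ⟨hp, hq, hk⟩ := hb prev last hpl c
    rw [map_mul, mul_k, mul_q, hp, hq, hk, map_zpow, zpow_k, zpow_q] at h
    simpa [pairHom, pairGen, hpl.ne', square] using h
  have hprev := (hal prev hpl.ne).2
  have hsq : (a last : ZMod (2 * 2 ^ α prev)) ^ 2 = 0 := by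
    obtain ⟨k, hk⟩ := hprev
    have := hpos prev
    rw [hk]
    push_cast
    rw [mul_pow, ← pow_mul (2 : ZMod (2 * 2 ^ α prev)), ZMod.two_pow_eq_zero (by omega), zero_mul]
  have hgl : g last ^ a last = 1 := by
    refine hgz _ _ ?_
    rcases (hmono hpl.le).eq_or_lt with h | h
    · rwa [← h]
    have h1 := hkq true (Or.inl rfl)
    have h3 := hkq false (Or.inr h)
    simp only [if_true, mul_one] at h1
    simp only [Bool.false_eq_true, if_false, mul_zero, zero_add] at h3
    -- With `a = a last`, the two test groups give `a ^ 2 + 2 * b = 0` and `a + 2 * b = 0`; since `a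
    -- ^ 2 = 0`, subtracting leaves `a = 0` modulo `2 ^ (α prev + 1)`.
    have h4 : ((a last : ℤ) : ZMod (2 * 2 ^ α prev)) = 0 := by
      linear_combination h3 - h1 + hsq
    rw [ZMod.intCast_zmod_eq_zero_iff_dvd] at h4
    have h5 : α last = α prev + 1 := by omega
    rw [h5, pow_succ']
    exact_mod_cast h4
  rw [hgl, inv_one, one_mul] at hu hb1
  refine hb1 fun i j hij => ?_
  obtain ⟨-, h, -⟩ := (htrans u hu).eqs hij (c := true) (Or.inl rfl)
  obtain ⟨-, hq, hk⟩ := hb i j hij true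
  rw [hq, hk, add_zero] at h
  exact ZMod.two_mul_intCast_eq_zero.1 h

end QuadGroup

theorem NilpotentProduct.isCapable_of_le_add_one {r : ℕ}
    (C : Fin r → Type u) [∀ i, Group (C i)]
    (x : (i : Fin r) → C i) (hx : ∀ i, Subgroup.zpowers (x i) = ⊤)
    (α : Fin r → ℕ) (hord : ∀ i, orderOf (x i) = 2 ^ α i)
    (hpos : ∀ i, 1 ≤ α i) (hmono : Monotone α)
    {last prev : Fin r} (hlast : ∀ l, l ≠ last → l < last) (hpl : prev < last)
    (hα : α last ≤ α prev + 1) :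
    IsCapable.{u, v} (NilpotentProduct 2 C) := by
  have hcl := closure_incl_eq_top hx
  have hker : ∀ w, FreeGroup.lift (fun i => (incl i (x i) : NilpotentProduct 2 C)) w = 1 →
      QuadGroup.TestCentral α w := fun w hw i j hij c hc l =>
    commute_lift_of_eq_one hx QuadGroup.commute_commutator_commutator
      (fun l l' => by rw [hord]; exact QuadGroup.commute_pairGen_pow α hpos hmono hij hc l l') hw l
  refine isCapable_of_freeGroup (FreeGroup.lift fun i => incl i (x i))
    (FreeGroup.lift_surjective_iff_closure_range_eq_top.2 hcl) _ fun w =>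
      Iff.trans ⟨hker w, fun hw => ?_⟩ (QuadGroup.testCentral_iff w)
  refine hw.lift_eq_one hpos hmono commutator_commutator_eq_one hcl (fun i => ?_) hker hlast hpl hα
  rw [← map_pow, ← hord, pow_orderOf_eq_one, map_one]

theorem mainTheorem4 (r : ℕ) (hr : 1 ≤ r)
    (C : Fin r → Type u) [∀ i, Group (C i)]
    (x : (i : Fin r) → C i) (hx : ∀ i, Subgroup.zpowers (x i) = ⊤)
    (α : Fin r → ℕ) (hord : ∀ i, orderOf (x i) = 2 ^ α i)
    (hpos : ∀ i, 1 ≤ α i) (hmono : Monotone α) :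
    IsCapable.{u, v} (NilpotentProduct 2 C) ↔
      ∃ _ : 1 < r, α ⟨r - 1, by omega⟩ ≤ α ⟨r - 2, by omega⟩ + 1 := by
  constructor
  · intro h
    obtain ⟨hr1, hα⟩ := NilpotentProduct.le_add_one_of_isCapable C x hx α hord hpos hmono
      (last := ⟨r - 1, by omega⟩) h
    refine ⟨hr1, hα _ fun l hl => ?_⟩
    simp only [ne_eq, Fin.ext_iff] at hl
    simp only [Fin.le_def]
    omega
  · rintro ⟨hr1, hα⟩
    refine NilpotentProduct.isCapable_of_le_add_one C x hx α hord hpos hmono (fun l hl => ?_) ?_ hα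
    · simp only [ne_eq, Fin.ext_iff] at hl
      simp only [Fin.lt_def]
      omega
    · simp only [Fin.lt_def]
      omega
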